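/- Let $\Omega\subset\mathbb{C}$ be a simply connected open set with $0\in\overline{\Omega}$, $0\notin\Omega$, star-shaped around $0$ in the sense that $ta\in\Omega$ for all $a\in\Omega$ and $t\in(0,1]$. Let $p,q$ be holomorphic functions on $\Omega$, with $p$ nowhere zero, put $k_0(a,a')=-q(a')/p(a)$, and let $k_\star$ be a holomorphic function on $\Omega\times\Omega$. Consider the Volterra operators $$[\mathcal V_0\varphi](a)=\int_0^a k_0(a,a')\,\varphi(a')\,da',\qquad [\mathcal V_\star\varphi](a)=\int_0^a k_\star(a,a')\,\varphi(a')\,da'\qquad(a\in\Omega),$$ where the integrals are taken along the straight path from $0$ to $a$. Suppose that, for some real constants $\tau>0$, $\gamma>0$ and $\lambda_\Delta$: - (sing) the function $k_0(a,a)-\tau/a$ is bounded on a neighborhood of $0$ in $\Omega$, and for each $\sigma>\tau$ there is a neighborhood of $(0,0)$ in $\Omega\times\Omega$ on which $|k_0(a,a')|<\sigma/|a|$; - (diag$_0$) there is a constant $M$ with $|k_0(a,a')|\le M\,\frac{1}{|a|}\,e^{\lambda_\Delta|a-a'|}$ for all $a,a'\in\Omega$; - (diag$_\star$) there is a constant $M$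 with $|k_\star(a,a')|\le M\,\frac{|a-a'|^\gamma}{|a|}\,e^{\lambda_\Delta|a-a'|}$ for all $a,a'\in\Omega$. For $\sigma,\Lambda\in\mathbb{R}$ let $\mathcal E^{\sigma}_{\Lambda}(\Omega)$ be the space of holomorphic functions $f$ on $\Omega$ with $\sup_{\zeta\in\Omega}|\zeta|^{-\sigma}e^{-\Lambda|\zeta|}|f(\zeta)|<\infty$, and let $\mathcal E^{\sigma}(\Omega)=\bigcup_{\Lambda\in\mathbb{R}}\mathcal E^{\sigma}_{\Lambda}(\Omega)$. Fix a base point $b\in\Omega$ and let $$f_0(a)=\frac{1}{p(a)}\exp\left(-\int_b^a\frac{q(\zeta)}{p(\zeta)}\,d\zeta\right)\qquad(a\in\Omega),$$ the integral being taken along any path from $b$ to $a$ in $\Omega$. Then $f_0\in\mathcal E^{\tau-1}(\Omega)$, the affine space $f_0+\mathcal E^{\tau-1+\gamma}(\Omega)$ is contained in $\mathcal E^{\tau-1}(\Omega)$, and the equation $f=\mathcal V_0f+\mathcal V_\star f$ has exactly one solution $f$ in $f_0+\mathcal E^{\tau-1+\gamma}(\Omega)$. -/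

import Mathlib

open Set Filter Topology MeasureTheory

noncomputable section

namespace SingularVolterra

/-- The standing assumptions on the domain: a simply connected open set of complex numbers that
touches but does not contain `0`, and is star-shaped around `0` (with the starting point `0` of
the straight paths omitted). -/
structure IsVolterraDomain (Ω : Set ℂ) : Prop where
  isOpen : IsOpen Ω
  simplyConnected : IsSimplyConnected Ω
  touches_zero : (0 : ℂ) ∈ closure Ω
  zero_notMem : (0 : ℂ) ∉ Ω
  star : ∀ a ∈ Ω, ∀ t : ℝ, 0 < t → t ≤ 1 → (t : ℂ) * a ∈ Ω

/-- The separable kernel `k₀(a, a') = - q(a') / p(a)`. -/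
def kernelZero (p q : ℂ → ℂ) (a a' : ℂ) : ℂ := -(q a' / p a)

/-- The regular singularity condition with constant `τ`. Neighborhoods of `0` in `Ω` and of
`(0, 0)` in `Ω × Ω` are traces of neighborhoods in `ℂ` and `ℂ × ℂ`. -/
def CondSing (Ω : Set ℂ) (k : ℂ → ℂ → ℂ) (τ : ℝ) : Prop :=
  0 < τ ∧
  (∃ C : ℝ, ∀ᶠ a in 𝓝[Ω] (0 : ℂ), ‖k a a - (τ : ℂ) / a‖ ≤ C) ∧
  ∀ σ : ℝ, τ < σ → ∀ᶠ x in 𝓝[Ω ×ˢ Ω] ((0 : ℂ), (0 : ℂ)), ‖k x.1 x.2‖ < σ / ‖x.1‖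

/-- The exponential bound away from the diagonal for the separable kernel. -/
def CondDiagZero (Ω : Set ℂ) (k : ℂ → ℂ → ℂ) (lam : ℝ) : Prop :=
  ∃ M : ℝ, ∀ a ∈ Ω, ∀ a' ∈ Ω, ‖k a a'‖ ≤ M * (1 / ‖a‖ * Real.exp (lam * ‖a - a'‖))

/-- The bound on the perturbing kernel, which makes it vanish to order `γ` on the diagonal. -/
def CondDiagStar (Ω : Set ℂ) (k : ℂ → ℂ → ℂ) (γ lam : ℝ) : Prop :=
  0 < γ ∧ ∃ M : ℝ, ∀ a ∈ Ω, ∀ a' ∈ Ω,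
    ‖k a a'‖ ≤ M * (‖a - a'‖ ^ γ / ‖a‖ * Real.exp (lam * ‖a - a'‖))

/-- The integrand of `∫_{ζ(a') = 0}^a w(a, a') φ(a') dζ(a')` along the straight path
`a' = t a`, for `t` from `0` to `1`. -/
def volterraIntegrand (w : ℂ → ℂ → ℂ) (φ : ℂ → ℂ) (a : ℂ) (t : ℝ) : ℂ :=
  w a ((t : ℂ) * a) * φ ((t : ℂ) * a) * a

/-- The Volterra operator with kernel `w`. -/
def volterra (w : ℂ → ℂ → ℂ) (φ : ℂ → ℂ) (a : ℂ) : ℂ :=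
  ∫ t in (0 : ℝ)..1, volterraIntegrand w φ a t

/-- `f` satisfies `f = (V₀ + V⋆) f` on `Ω`, where `V₀` and `V⋆` are the Volterra operators with
kernels `k₀` and `kstar`; this includes the convergence of the integrals. -/
def IsSolution (Ω : Set ℂ) (k₀ kstar : ℂ → ℂ → ℂ) (f : ℂ → ℂ) : Prop :=
  ∀ a ∈ Ω,
    IntervalIntegrable (volterraIntegrand k₀ f a) volume 0 1 ∧
    IntervalIntegrable (volterraIntegrand kstar f a) volume 0 1 ∧
    f a = volterra k₀ f a + volterra kstar f a

/-- The space of holomorphic functions on `Ω` with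
`sup_Ω |ζ|^{-σ} e^{-Λ|ζ|} |f| < ∞`. Functions on `Ω` are represented by functions on `ℂ`, whose
values outside `Ω` are irrelevant. -/
def expSpace (Ω : Set ℂ) (σ lam : ℝ) : Set (ℂ → ℂ) :=
  {f | DifferentiableOn ℂ f Ω ∧
    ∃ M : ℝ, ∀ z ∈ Ω, ‖z‖ ^ (-σ) * Real.exp (-lam * ‖z‖) * ‖f z‖ ≤ M}

/-- The union over all real exponential types of the spaces `expSpace Ω σ lam`. -/
def expSpaceUnion (Ω : Set ℂ) (σ : ℝ) : Set (ℂ → ℂ) :=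
  ⋃ lam : ℝ, expSpace Ω σ lam

/-- The continuously differentiable paths from `b` to `a` in `Ω`. -/
def IsPathIn (Ω : Set ℂ) {b a : ℂ} (γ : Path b a) : Prop :=
  (∀ t, γ t ∈ Ω) ∧ ContDiffOn ℝ 1 γ.extend (Icc 0 1)

/-- Any two points of a connected open set are joined by such a path. -/
theorem exists_isPathIn {Ω : Set ℂ} (ho : IsOpen Ω) (hc : IsPreconnected Ω) {b a : ℂ}
    (hb : b ∈ Ω) (ha : a ∈ Ω) : ∃ γ : Path b a, IsPathIn Ω γ := by
  let R : ℂ → ℂ → Prop := fun x y => ∃ F : ℝ → ℂ, ContDiff ℝ 1 F ∧ (∀ t ≤ 0, F t = x) ∧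
    (∀ t, 1 ≤ t → F t = y) ∧ ∀ t, F t ∈ Ω
  have htrans : ∀ x y z, R x y → R y z → R x z := by
    rintro x y z ⟨F, hF, hF0, hF1, hFm⟩ ⟨G, hG, hG0, hG1, hGm⟩
    refine ⟨fun t => F (2 * t) + G (2 * t - 1) - y, ?_, ?_, ?_, ?_⟩
    · exact ((hF.comp (by fun_prop)).add (hG.comp (by fun_prop))).sub contDiff_const
    · intro t ht
      simp [hF0 (2 * t) (by linarith), hG0 (2 * t - 1) (by linarith)]
    · intro t ht
      simp [hF1 (2 * t) (by linarith), hG1 (2 * t - 1) (by linarith)]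
    · intro t
      rcases le_total t (1 / 2) with h | h
      · simpa [hG0 (2 * t - 1) (by linarith)] using hFm (2 * t)
      · simpa [hF1 (2 * t) (by linarith)] using hGm (2 * t - 1)
  have hsymm : ∀ x y, R x y → R y x := by
    rintro x y ⟨F, hF, hF0, hF1, hFm⟩
    exact ⟨fun t => F (1 - t), hF.comp (by fun_prop), fun t ht => hF1 _ (by linarith),
      fun t ht => hF0 _ (by linarith), fun t => hFm _⟩
  have hloc : ∀ x ∈ Ω, ∀ᶠ y in 𝓝[Ω] x, R x y := by
    intro x hx
    obtain ⟨r, hr, hrΩ⟩ := Metric.isOpen_iff.1 ho x hx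
    filter_upwards [nhdsWithin_le_nhds (Metric.ball_mem_nhds x hr)] with y hy
    refine ⟨fun t => x + (Real.smoothTransition t : ℝ) • (y - x), ?_, ?_, ?_, ?_⟩
    · exact contDiff_const.add (Real.smoothTransition.contDiff.smul contDiff_const)
    · intro t ht
      simp [Real.smoothTransition.zero_of_nonpos ht]
    · intro t ht
      simp [Real.smoothTransition.one_of_one_le ht]
    · intro t
      exact hrΩ ((convex_ball x r).add_smul_sub_mem (Metric.mem_ball_self hr) hy
        ⟨Real.smoothTransition.nonneg t, Real.smoothTransition.le_one t⟩)
  have hR : R b a := by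
    refine hc.induction₂ R (fun x hx => ?_) (fun x y z _ _ _ => htrans x y z)
      (fun x y _ _ => hsymm x y) hb ha
    exact hloc x hx
  obtain ⟨F, hF, hF0, hF1, hFm⟩ := hR
  refine ⟨⟨⟨fun t => F t, hF.continuous.comp continuous_subtype_val⟩, by simpa using hF0 0 le_rfl,
    by simpa using hF1 1 le_rfl⟩, fun t => hFm t, ?_⟩
  refine hF.contDiffOn.congr fun t ht => ?_
  rw [Path.extend_apply _ ht]
  rfl

open Classical in
/-- The integral `∫_b^a h dζ` along a continuously differentiable path from `b` to `a` in `Ω`. On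
a simply connected open set all such paths give the same value when `h` is holomorphic, so the
choice of the path is irrelevant. -/
def pathIntegral (Ω : Set ℂ) (h : ℂ → ℂ) (b a : ℂ) : ℂ :=
  if H : ∃ γ : Path b a, IsPathIn Ω γ then
    curveIntegral (fun z => h z • (1 : ℂ →L[ℂ] ℂ)) H.choose
  else 0

/-- The prototype solution `f₀(a) = (1 / p(a)) exp (- ∫_b^a (q / p) dζ)` with base point `b`. -/
def prototype (Ω : Set ℂ) (p q : ℂ → ℂ) (b a : ℂ) : ℂ :=
  1 / p a * Complex.exp (-pathIntegral Ω (fun z => q z / p z) b a)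

end SingularVolterra

end

/-! On a ray `a' = t a` the singular kernel is about `τ / ‖a‖` near `0`, so on functions of size
`‖a‖ ^ σ` the operator V₀ has norm about `τ * ∫ t ^ σ = τ / (σ + 1)`. For `σ = τ - 1` this is `1`,
which leaves room for the fixed point f₀; for `σ = τ - 1 + γ` it is `τ / (τ + γ) < 1`. Far from `0`,
a large exponential type Λ supplies the damping `exp (-(Λ - λ) (1 - t) ‖a‖)`, which also makes V⋆
small. Hence V₀ + V⋆ contracts the space of order `τ - 1 + γ` once Λ is large
(`eventually_norm_volterra_le_of_condSing`, `CondDiagStar.eventually_norm_volterra_le`).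

The function `g = p f₀` satisfies `g' = -(q / p) g`, and `-q / p = τ / a + O(1)` makes it vanish
like `‖a‖ ^ τ` at `0`. Since k₀ is separable, V₀ f₀ is `1 / p(a)` times the integral of `g'`, that
is f₀ (`prototype_spec`).

With `f = f₀ + h` the equation becomes `h = V⋆ f₀ + (V₀ + V⋆) h`. The source V⋆ f₀ has order `τ - 1
+ γ` because k⋆ vanishes to order γ on the diagonal, so a Neumann series gives h. The difference of
two solutions is a fixed point of a contraction, hence zero. -/

namespace SingularVolterra

/-! ### Differentiation under the integral sign -/

/-- Integrals of dominated holomorphic families are holomorphic, and may be differentiated under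
the integral sign. -/
theorem hasDerivAt_integral_of_dominated {Ω : Set ℂ} (ho : IsOpen Ω) {F : ℂ → ℝ → ℂ}
    (hcont : ∀ z ∈ Ω, ContinuousOn (F z) (Ioc 0 1))
    (hdiff : ∀ t ∈ Ioc (0 : ℝ) 1, DifferentiableOn ℂ (fun z => F z t) Ω)
    {m : ℂ → ℝ} (hm : ContinuousOn m Ω) {β : ℝ → ℝ} (hβ : IntervalIntegrable β volume 0 1)
    (hβ0 : ∀ t ∈ Ioc (0 : ℝ) 1, 0 ≤ β t)
    (hF : ∀ z ∈ Ω, ∀ t ∈ Ioc (0 : ℝ) 1, ‖F z t‖ ≤ m z * β t) {a : ℂ} (ha : a ∈ Ω) :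
    IntervalIntegrable (F a) volume 0 1 ∧
    IntervalIntegrable (fun t => deriv (fun z => F z t) a) volume 0 1 ∧
    HasDerivAt (fun z => ∫ t in (0 : ℝ)..1, F z t)
      (∫ t in (0 : ℝ)..1, deriv (fun z => F z t) a) a := by
  have hmeas : ∀ z ∈ Ω, AEStronglyMeasurable (F z) (volume.restrict (uIoc (0 : ℝ) 1)) := by
    intro z hz
    rw [uIoc_of_le zero_le_one]
    exact (hcont z hz).aestronglyMeasurable measurableSet_Ioc
  have hint : IntervalIntegrable (F a) volume 0 1 := by
    refine (hβ.const_mul (m a)).mono_fun' (hmeas a ha) ?_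
    rw [uIoc_of_le zero_le_one]
    exact (ae_restrict_iff' measurableSet_Ioc).2 (.of_forall fun t ht => hF a ha t ht)
  obtain ⟨r, hr, hrΩ, hrm⟩ : ∃ r > 0, Metric.ball a r ⊆ Ω ∧
      ∀ z ∈ Metric.ball a r, m z ≤ m a + 1 := by
    have h1 : ∀ᶠ z in 𝓝 a, m z < m a + 1 :=
      ((hm.continuousAt (ho.mem_nhds ha)).tendsto).eventually_lt_const (by linarith)
    obtain ⟨r, hr, h⟩ := Metric.mem_nhds_iff.1 (inter_mem h1 (ho.mem_nhds ha))
    exact ⟨r, hr, fun z hz => (h hz).2, fun z hz => (h hz).1.le⟩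
  -- Difference quotients along a sequence inside the ball exhibit the derivative as a pointwise
  -- limit of functions measurable in `t`.
  have hlim : ∀ t ∈ Ioc (0 : ℝ) 1, Tendsto
      (fun n : ℕ => ((r / 2 / (n + 1 : ℝ) : ℝ) : ℂ)⁻¹ • (F (a + ((r / 2 / (n + 1 : ℝ) : ℝ) : ℂ)) t
        - F a t)) atTop (𝓝 (deriv (fun z => F z t) a)) := by
    intro t ht
    have hd := ((hdiff t ht).differentiableAt (ho.mem_nhds ha)).hasDerivAt
    refine (hasDerivAt_iff_tendsto_slope_zero.1 hd).comp ?_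
    refine tendsto_nhdsWithin_iff.2 ⟨?_, .of_forall fun n => ?_⟩
    · have h := (tendsto_one_div_add_atTop_nhds_zero_nat (𝕜 := ℝ)).const_mul (r / 2)
      rw [mul_zero] at h
      have h2 := (Complex.continuous_ofReal.tendsto _).comp h
      simpa [Function.comp_def, div_eq_mul_inv] using h2
    · simp only [mem_compl_iff, mem_singleton_iff, Complex.ofReal_eq_zero]
      positivity
  have hmeas' : AEStronglyMeasurable (fun t => deriv (fun z => F z t) a)
      (volume.restrict (uIoc (0 : ℝ) 1)) := by
    refine aestronglyMeasurable_of_tendsto_ae atTop (f := fun (n : ℕ) t =>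
      ((r / 2 / (n + 1 : ℝ) : ℝ) : ℂ)⁻¹ • (F (a + ((r / 2 / (n + 1 : ℝ) : ℝ) : ℂ)) t - F a t))
      (fun n => ?_) ?_
    · refine AEStronglyMeasurable.const_smul (𝕜 := ℂ) ((hmeas _ (hrΩ ?_)).sub (hmeas a ha)) _
      have : r / 2 / (n + 1 : ℝ) < r := by
        rw [div_lt_iff₀ (by positivity)]
        nlinarith [(n.cast_nonneg : (0 : ℝ) ≤ n)]
      simp only [Metric.mem_ball, dist_self_add_left, Complex.norm_real, Real.norm_eq_abs]
      rwa [abs_of_nonneg (by positivity)]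
    · rw [uIoc_of_le zero_le_one]
      exact (ae_restrict_iff' measurableSet_Ioc).2 (.of_forall hlim)
  refine ⟨hint, intervalIntegral.hasDerivAt_integral_of_dominated_loc_of_deriv_le
    (F' := fun z t => deriv (fun w => F w t) z)
    (bound := fun t => ((m a + 1) / (r / 2)) * β t)
    (s := Metric.ball a (r / 2)) (Metric.ball_mem_nhds a (by positivity)) ?_ hint hmeas' ?_
    (hβ.const_mul _) ?_⟩
  · filter_upwards [ho.mem_nhds ha] with z hz using hmeas z hz
  · refine .of_forall fun t ht z hz => ?_
    rw [uIoc_of_le zero_le_one] at ht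
    -- Circles of radius `r / 2` about points of the half ball stay where `m ≤ m a + 1`, so Cauchy's
    -- estimate gives the bound `(m a + 1) / (r / 2) * β t`.
    have hsub : Metric.closedBall z (r / 2) ⊆ Metric.ball a r := by
      intro w hw
      rw [Metric.mem_ball] at hz ⊢
      rw [Metric.mem_closedBall] at hw
      linarith [dist_triangle w z a]
    have h := Complex.norm_deriv_le_of_forall_mem_sphere_norm_le (f := fun w => F w t) (c := z)
      (R := r / 2) (C := (m a + 1) * β t) (by positivity)
      (((hdiff t ht).mono (hsub.trans hrΩ)).diffContOnCl_ball subset_rfl) ?_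
    · calc _ ≤ _ := h
        _ = _ := by ring
    · intro w hw
      have hw' := hsub (Metric.sphere_subset_closedBall hw)
      exact (hF w (hrΩ hw') t ht).trans (mul_le_mul_of_nonneg_right (hrm w hw') (hβ0 t ht))
  · refine .of_forall fun t ht z hz => ?_
    rw [uIoc_of_le zero_le_one] at ht
    refine ((hdiff t ht).differentiableAt (ho.mem_nhds (hrΩ ?_))).hasDerivAt
    exact Metric.ball_subset_ball (by linarith) hz

/-! ### Contractions in weighted sup norms -/

/-- `f` is holomorphic on `Ω` and dominated there by the multiple `K * W` of the weight `W`. -/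
def Dominated (Ω : Set ℂ) (W : ℂ → ℝ) (K : ℝ) (f : ℂ → ℂ) : Prop :=
  DifferentiableOn ℂ f Ω ∧ ∀ z ∈ Ω, ‖f z‖ ≤ K * W z

theorem Dominated.sub {Ω : Set ℂ} {W : ℂ → ℝ} {K K' : ℝ} {f g : ℂ → ℂ}
    (hf : Dominated Ω W K f) (hg : Dominated Ω W K' g) : Dominated Ω W (K + K') (f - g) := by
  refine ⟨hf.1.sub hg.1, fun z hz => ?_⟩
  rw [add_mul]
  exact (norm_sub_le _ _).trans (add_le_add (hf.2 z hz) (hg.2 z hz))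

theorem Dominated.add {Ω : Set ℂ} {W : ℂ → ℝ} {K K' : ℝ} {f g : ℂ → ℂ}
    (hf : Dominated Ω W K f) (hg : Dominated Ω W K' g) : Dominated Ω W (K + K') (f + g) := by
  refine ⟨hf.1.add hg.1, fun z hz => ?_⟩
  rw [add_mul]
  exact (norm_add_le _ _).trans (add_le_add (hf.2 z hz) (hg.2 z hz))

/-- The Neumann series of an operator contracting a weighted sup norm. -/
theorem exists_dominated_fixedPoint {Ω : Set ℂ} (ho : IsOpen Ω) {W : ℂ → ℝ}
    (hW : ContinuousOn W Ω) {T : (ℂ → ℂ) → ℂ → ℂ} {κ : ℝ}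
    (hκ0 : 0 ≤ κ) (hκ1 : κ < 1)
    (hT : ∀ f K, 0 ≤ K → Dominated Ω W K f → Dominated Ω W (κ * K) (T f))
    (hTsub : ∀ f g K K', Dominated Ω W K f → Dominated Ω W K' g →
      ∀ z ∈ Ω, T (f - g) z = T f z - T g z)
    {h₀ : ℂ → ℂ} {K : ℝ} (hK : 0 ≤ K) (hh : Dominated Ω W K h₀) :
    ∃ h, (∃ K', Dominated Ω W K' h) ∧ ∀ z ∈ Ω, h z = h₀ z + T h z := by
  set d : ℕ → ℂ → ℂ := fun n => T^[n] h₀ with hd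
  have hdom : ∀ n, Dominated Ω W (κ ^ n * K) (d n) := by
    intro n
    induction n with
    | zero => simpa [hd] using hh
    | succ n ih =>
      have := hT _ _ (by positivity) ih
      rw [hd] at this ⊢
      simp only [Function.iterate_succ_apply'] at this ⊢
      convert this using 1
      ring
  have hgeo : Summable fun n : ℕ => κ ^ n := summable_geometric_of_lt_one hκ0 hκ1
  have hsumnorm : ∀ z ∈ Ω, Summable fun n => κ ^ n * K * W z := fun z hz =>
    (hgeo.mul_right K).mul_right (W z)
  have hsum : ∀ z ∈ Ω, Summable fun n => d n z := fun z hz =>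
    Summable.of_norm_bounded (hsumnorm z hz) fun n => (hdom n).2 z hz
  set h : ℂ → ℂ := fun z => ∑' n, d n z with hh'
  have hdiffh : DifferentiableOn ℂ h Ω := by
    intro a ha
    have h1 : ∀ᶠ z in 𝓝 a, W z < W a + 1 :=
      ((hW.continuousAt (ho.mem_nhds ha)).tendsto).eventually_lt_const (by linarith)
    obtain ⟨r, hr, hrs⟩ := Metric.mem_nhds_iff.1 (inter_mem h1 (ho.mem_nhds ha))
    have := Complex.differentiableOn_tsum_of_summable_norm (F := d) (U := Metric.ball a r)
      (u := fun n => κ ^ n * K * (W a + 1)) ((hgeo.mul_right K).mul_right _)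
      (fun n => (hdom n).1.mono fun z hz => (hrs hz).2) Metric.isOpen_ball
      (fun n z hz => ((hdom n).2 z (hrs hz).2).trans
        (mul_le_mul_of_nonneg_left (le_of_lt (hrs hz).1) (by positivity)))
    exact (this.differentiableAt (Metric.ball_mem_nhds a hr)).differentiableWithinAt
  -- The geometric bound on tails replaces continuity of `T`: it lets `T h` be reached from partial
  -- sums. The case `N = 0` bounds `h` itself.
  have htail : ∀ N, Dominated Ω W (κ ^ N * ((1 - κ)⁻¹ * K))
      (h - fun z => ∑ n ∈ Finset.range N, d n z) := by
    intro N
    refine ⟨hdiffh.sub (DifferentiableOn.fun_sum fun n _ => (hdom n).1), fun z hz => ?_⟩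
    have h1 : (h - fun z => ∑ n ∈ Finset.range N, d n z) z = ∑' n, d (n + N) z := by
      rw [Pi.sub_apply, hh', sub_eq_iff_eq_add, add_comm]
      exact ((hsum z hz).sum_add_tsum_nat_add N).symm
    rw [h1]
    have h2 : HasSum (fun n => κ ^ n * (κ ^ N * K * W z)) ((1 - κ)⁻¹ * (κ ^ N * K * W z)) :=
      (hasSum_geometric_of_lt_one hκ0 hκ1).mul_right _
    refine (tsum_of_norm_bounded h2 fun n => ?_).trans (le_of_eq (by ring))
    exact ((hdom (n + N)).2 z hz).trans (le_of_eq (by ring))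
  have hκ1' : 0 ≤ (1 - κ)⁻¹ := inv_nonneg.2 (by linarith)
  have hhdom : Dominated Ω W ((1 - κ)⁻¹ * K) h := by
    have := htail 0
    simp only [Finset.range_zero, Finset.sum_empty, pow_zero, one_mul] at this
    convert this using 1
    ext z; simp
  have hSdom : ∀ N, ∃ K', Dominated Ω W K' (fun z => ∑ n ∈ Finset.range N, d n z) := by
    intro N
    have := hhdom.sub (htail N)
    rw [sub_sub_cancel] at this
    exact ⟨_, this⟩
  -- Only compatibility with subtraction is available, so the induction removes the last term. The
  -- base case is `T 0 = 0`, from `hT` with `K = 0`.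
  have hTS : ∀ N, ∀ z ∈ Ω, T (fun z => ∑ n ∈ Finset.range N, d n z) z =
      ∑ n ∈ Finset.range N, d (n + 1) z := by
    intro N
    induction N with
    | zero =>
      intro z hz
      have := (hT (fun _ => 0) 0 le_rfl ⟨differentiableOn_const _, fun z hz => by simp⟩).2 z hz
      simpa using this
    | succ N ih =>
      intro z hz
      obtain ⟨K', hK'⟩ := hSdom (N + 1)
      have h1 := hTsub _ _ _ _ hK' (hdom N) z hz
      have h2 : ((fun z => ∑ n ∈ Finset.range (N + 1), d n z) - d N) =
          fun z => ∑ n ∈ Finset.range N, d n z := by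
        ext z; simp [Finset.sum_range_succ]
      rw [h2, ih z hz] at h1
      rw [Finset.sum_range_succ, h1]
      simp only [hd, Function.iterate_succ_apply']
      ring
  refine ⟨h, ⟨_, hhdom⟩, fun z hz => ?_⟩
  have hlim1 : Tendsto (fun N => T h z - ∑ n ∈ Finset.range N, d (n + 1) z) atTop (𝓝 0) := by
    refine squeeze_zero_norm (a := fun N => κ * (κ ^ N * ((1 - κ)⁻¹ * K)) * W z) (fun N => ?_) ?_
    · obtain ⟨K', hK'⟩ := hSdom N
      rw [← hTS N z hz, ← hTsub _ _ _ _ hhdom hK' z hz]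
      exact (hT _ _ (by positivity) (htail N)).2 z hz
    · have := (((tendsto_pow_atTop_nhds_zero_of_lt_one hκ0 hκ1).mul_const
        ((1 - κ)⁻¹ * K)).const_mul κ).mul_const (W z)
      simpa using this
  have hlim2 : Tendsto (fun N => T h z - ∑ n ∈ Finset.range N, d (n + 1) z) atTop
      (𝓝 (T h z - ∑' n, d (n + 1) z)) :=
    tendsto_const_nhds.sub (((summable_nat_add_iff 1).2 (hsum z hz)).hasSum.tendsto_sum_nat)
  have h3 := tendsto_nhds_unique hlim1 hlim2
  have h4 : h z = d 0 z + ∑' n, d (n + 1) z := (hsum z hz).tsum_eq_zero_add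
  rw [h4, ← sub_eq_zero.1 h3.symm]
  rfl

/-- A fixed point of an operator contracting a weighted sup norm vanishes. -/
theorem eqOn_zero_of_fixedPoint {Ω : Set ℂ} {W : ℂ → ℝ} {T : (ℂ → ℂ) → ℂ → ℂ} {κ : ℝ}
    (hκ0 : 0 ≤ κ) (hκ1 : κ < 1)
    (hT : ∀ f K, 0 ≤ K → Dominated Ω W K f → Dominated Ω W (κ * K) (T f))
    {f : ℂ → ℂ} {K : ℝ} (hK : 0 ≤ K) (hf : Dominated Ω W K f) (hfix : ∀ z ∈ Ω, f z = T f z) :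
    ∀ z ∈ Ω, f z = 0 := by
  have hn : ∀ n : ℕ, Dominated Ω W (κ ^ n * K) f := by
    intro n
    induction n with
    | zero => simpa using hf
    | succ n ih =>
      refine ⟨hf.1, fun z hz => ?_⟩
      rw [hfix z hz, pow_succ', mul_assoc κ]
      exact (hT _ _ (by positivity) ih).2 z hz
  intro z hz
  have hlim : Tendsto (fun n : ℕ => κ ^ n * K * W z) atTop (𝓝 0) := by
    simpa using ((tendsto_pow_atTop_nhds_zero_of_lt_one hκ0 hκ1).mul_const K).mul_const (W z)
  exact norm_le_zero_iff.1 (ge_of_tendsto' hlim fun n => (hn n).2 z hz)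

/-! ### Weights and exponential type -/

/-- This is `y ≤ exp y` at `y = μ x / γ`, raised to the power `γ`. The constant tends to `0` as `μ →
∞`, which is the source of the smallness of V⋆. -/
theorem rpow_le_mul_exp {γ μ x : ℝ} (hγ : 0 < γ) (hμ : 0 < μ) (hx : 0 ≤ x) :
    x ^ γ ≤ (γ / μ) ^ γ * Real.exp (μ * x) := by
  have h1 : μ * x / γ ≤ Real.exp (μ * x / γ) := by linarith [Real.add_one_le_exp (μ * x / γ)]
  have h2 : x = γ / μ * (μ * x / γ) := by field_simp
  calc x ^ γ = (γ / μ * (μ * x / γ)) ^ γ := by rw [← h2]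
    _ = (γ / μ) ^ γ * (μ * x / γ) ^ γ := Real.mul_rpow (by positivity) (by positivity)
    _ ≤ (γ / μ) ^ γ * (Real.exp (μ * x / γ)) ^ γ := by gcongr
    _ = _ := by
      rw [← Real.exp_mul]
      congr 2
      field_simp

/-- The weight `|z|^σ e^{Λ|z|}`. -/
noncomputable def weight (σ lam : ℝ) (z : ℂ) : ℝ := ‖z‖ ^ σ * Real.exp (lam * ‖z‖)

theorem weight_nonneg (σ lam : ℝ) (z : ℂ) : 0 ≤ weight σ lam z := by
  unfold weight; positivity

theorem weight_mono {σ lam lam' : ℝ} (h : lam ≤ lam') (z : ℂ) :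
    weight σ lam z ≤ weight σ lam' z := by
  unfold weight; gcongr

theorem continuousOn_weight {Ω : Set ℂ} (h0 : (0 : ℂ) ∉ Ω) (σ lam : ℝ) :
    ContinuousOn (weight σ lam) Ω := by
  unfold weight
  refine ContinuousOn.mul (continuous_norm.continuousOn.rpow_const fun z hz => .inl ?_)
    (by fun_prop)
  exact norm_ne_zero_iff.2 (ne_of_mem_of_not_mem hz h0)

theorem Dominated.mono {Ω : Set ℂ} {σ lam lam' K K' : ℝ} {f : ℂ → ℂ} (hlam : lam ≤ lam')
    (hK0 : 0 ≤ K') (hK : K ≤ K') (hf : Dominated Ω (weight σ lam) K f) :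
    Dominated Ω (weight σ lam') K' f :=
  ⟨hf.1, fun z hz => (hf.2 z hz).trans
    (mul_le_mul hK (weight_mono hlam z) (weight_nonneg _ _ _) hK0)⟩

theorem mem_expSpace_iff {Ω : Set ℂ} (h0 : (0 : ℂ) ∉ Ω) {σ lam : ℝ} {f : ℂ → ℂ} :
    f ∈ expSpace Ω σ lam ↔ ∃ K, 0 ≤ K ∧ Dominated Ω (weight σ lam) K f := by
  have key : ∀ z ∈ Ω, ∀ M, ‖z‖ ^ (-σ) * Real.exp (-lam * ‖z‖) * ‖f z‖ ≤ M ↔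
      ‖f z‖ ≤ M * weight σ lam z := by
    intro z hz M
    have hz0 : 0 < ‖z‖ := norm_pos_iff.2 (ne_of_mem_of_not_mem hz h0)
    rw [weight, Real.rpow_neg hz0.le, neg_mul, Real.exp_neg, ← mul_inv,
      inv_mul_le_iff₀ (by positivity), mul_comm]
  constructor
  · rintro ⟨hd, M, hM⟩
    exact ⟨max M 0, le_max_right _ _, hd, fun z hz => ((key z hz M).1 (hM z hz)).trans
      (mul_le_mul_of_nonneg_right (le_max_left _ _) (weight_nonneg _ _ _))⟩
  · rintro ⟨K, -, hd, hK⟩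
    exact ⟨hd, K, fun z hz => (key z hz K).2 (hK z hz)⟩

theorem mem_expSpaceUnion_iff {Ω : Set ℂ} (h0 : (0 : ℂ) ∉ Ω) {σ : ℝ} {f : ℂ → ℂ} :
    f ∈ expSpaceUnion Ω σ ↔ ∃ lam K, 0 ≤ K ∧ Dominated Ω (weight σ lam) K f := by
  simp only [expSpaceUnion, mem_iUnion, mem_expSpace_iff h0]

/-- A faster vanishing at `0` can be traded for exponential growth. -/
theorem Dominated.lower {Ω : Set ℂ} (h0 : (0 : ℂ) ∉ Ω) {σ γ lam K : ℝ} (hγ : 0 < γ) (hK : 0 ≤ K)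
    {f : ℂ → ℂ} (hf : Dominated Ω (weight (σ + γ) lam) K f) :
    Dominated Ω (weight σ (lam + 1)) (K * γ ^ γ) f := by
  refine ⟨hf.1, fun z hz => (hf.2 z hz).trans ?_⟩
  have hz0 : 0 < ‖z‖ := norm_pos_iff.2 (ne_of_mem_of_not_mem hz h0)
  have := rpow_le_mul_exp hγ one_pos hz0.le
  rw [mul_assoc]
  refine mul_le_mul_of_nonneg_left ?_ hK
  unfold weight
  rw [Real.rpow_add hz0, add_mul, Real.exp_add]
  rw [div_one, one_mul] at this
  calc ‖z‖ ^ σ * ‖z‖ ^ γ * Real.exp (lam * ‖z‖)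
      ≤ ‖z‖ ^ σ * (γ ^ γ * Real.exp ‖z‖) * Real.exp (lam * ‖z‖) := by gcongr
    _ = _ := by rw [one_mul]; ring

/-! ### Volterra operators on weighted spaces -/

section Operator

variable {Ω : Set ℂ}

theorem IsVolterraDomain.smul_mem (hΩ : IsVolterraDomain Ω) {a : ℂ} (ha : a ∈ Ω) {t : ℝ}
    (ht : t ∈ Ioc (0 : ℝ) 1) : (t : ℂ) * a ∈ Ω :=
  hΩ.star a ha t ht.1 ht.2

theorem weight_smul {σ lam t : ℝ} (ht : 0 < t) (a : ℂ) :
    weight σ lam ((t : ℂ) * a) = t ^ σ * ‖a‖ ^ σ * Real.exp (lam * (t * ‖a‖)) := by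
  rw [weight, norm_mul, Complex.norm_real, Real.norm_of_nonneg ht.le,
    Real.mul_rpow ht.le (norm_nonneg _)]

/-- Growth condition on a kernel which makes its Volterra integrals converge. -/
def RayBounded (Ω : Set ℂ) (w : ℂ → ℂ → ℂ) : Prop :=
  ∃ A B : ℝ, 0 ≤ A ∧
    ∀ a ∈ Ω, ∀ t ∈ Ioc (0 : ℝ) 1, ‖w a ((t : ℂ) * a)‖ * ‖a‖ ≤ A * Real.exp (B * ‖a‖)

/-- The integrand is holomorphic in the endpoint for each `t` and dominated by a multiple of `t ^
σ`, integrable because `σ > -1`. -/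
theorem volterra_regular (hΩ : IsVolterraDomain Ω) {w : ℂ → ℂ → ℂ}
    (hw : DifferentiableOn ℂ (fun x : ℂ × ℂ => w x.1 x.2) (Ω ×ˢ Ω)) (hb : RayBounded Ω w)
    {σ lam K : ℝ} (hσ : -1 < σ) (hK : 0 ≤ K) {f : ℂ → ℂ} (hf : Dominated Ω (weight σ lam) K f) :
    (∀ a ∈ Ω, IntervalIntegrable (volterraIntegrand w f a) volume 0 1) ∧
      DifferentiableOn ℂ (volterra w f) Ω := by
  obtain ⟨A, B, hA, hAB⟩ := hb
  have hcont : ∀ z ∈ Ω, ContinuousOn (volterraIntegrand w f z) (Ioc 0 1) := by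
    intro z hz
    have hmap : ∀ t ∈ Ioc (0 : ℝ) 1, (t : ℂ) * z ∈ Ω := fun t ht => hΩ.smul_mem hz ht
    have hc : ContinuousOn (fun t : ℝ => (t : ℂ) * z) (Ioc 0 1) := by fun_prop
    refine ContinuousOn.mul (ContinuousOn.mul ?_ (hf.1.continuousOn.comp hc hmap))
      continuousOn_const
    exact hw.continuousOn.comp (continuousOn_const.prodMk hc) fun t ht => ⟨hz, hmap t ht⟩
  have hdiff : ∀ t ∈ Ioc (0 : ℝ) 1, DifferentiableOn ℂ (fun z => volterraIntegrand w f z t) Ω := by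
    intro t ht
    have hmap : ∀ z ∈ Ω, (t : ℂ) * z ∈ Ω := fun z hz => hΩ.smul_mem hz ht
    have hc : DifferentiableOn ℂ (fun z : ℂ => (t : ℂ) * z) Ω := by fun_prop
    refine DifferentiableOn.mul (DifferentiableOn.mul ?_ (hf.1.comp hc hmap)) differentiableOn_id
    exact hw.comp (differentiableOn_id.prodMk hc) fun z hz => ⟨hz, hmap z hz⟩
  have key := fun a (ha : a ∈ Ω) => hasDerivAt_integral_of_dominated hΩ.isOpen hcont hdiff
    -- The absolute value covers negative `lam`, for which `exp (lam * t * ‖z‖)` is largest near `t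
    -- = 0`.
    (m := fun z => A * Real.exp (B * ‖z‖) * (K * weight σ |lam| z)) (β := fun t => t ^ σ)
    (ContinuousOn.mul (by fun_prop)
      (continuousOn_const.mul (continuousOn_weight hΩ.zero_notMem σ |lam|)))
    (intervalIntegral.intervalIntegrable_rpow' hσ) (fun t ht => by have := ht.1; positivity)
    (by
      intro z hz t ht
      have ht0 := ht.1
      have h1 := hf.2 _ (hΩ.smul_mem hz ht)
      rw [weight_smul ht0] at h1
      have h2 : Real.exp (lam * (t * ‖z‖)) ≤ Real.exp (|lam| * ‖z‖) := by
        refine Real.exp_le_exp.2 ?_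
        calc lam * (t * ‖z‖) ≤ |lam| * (t * ‖z‖) := by gcongr; exact le_abs_self _
          _ ≤ |lam| * ‖z‖ := by
            gcongr
            exact mul_le_of_le_one_left (norm_nonneg _) ht.2
      rw [volterraIntegrand, norm_mul, norm_mul]
      calc ‖w z (t * z)‖ * ‖f (t * z)‖ * ‖z‖ = ‖w z (t * z)‖ * ‖z‖ * ‖f (t * z)‖ := by ring
        _ ≤ A * Real.exp (B * ‖z‖) * (K * (t ^ σ * ‖z‖ ^ σ * Real.exp (|lam| * ‖z‖))) := by
          refine mul_le_mul (hAB z hz t ht) (h1.trans ?_) (norm_nonneg _) (by positivity)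
          gcongr
        _ = _ := by rw [weight]; ring) ha
  exact ⟨fun a ha => (key a ha).1, fun a ha =>
    (key a ha).2.2.differentiableAt.differentiableWithinAt⟩

/-- The factors `exp (lam (1 - t) ‖a‖)` of the kernel and `exp (lam t ‖a‖)` of the function multiply
to the weight at `a`, leaving `∫ β t ^ σ`. Every norm estimate below is a choice of `β`, which may
depend on `a`. -/
theorem norm_volterra_le (hΩ : IsVolterraDomain Ω) {w : ℂ → ℂ → ℂ} {σ lam K : ℝ}
    {f : ℂ → ℂ} (hf : ∀ z ∈ Ω, ‖f z‖ ≤ K * weight σ lam z) {a : ℂ} (ha : a ∈ Ω) {β : ℝ → ℝ}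
    (hβ : IntervalIntegrable (fun t => β t * t ^ σ) volume 0 1)
    (hw : ∀ t ∈ Ioc (0 : ℝ) 1,
      ‖w a ((t : ℂ) * a)‖ * ‖a‖ ≤ β t * Real.exp (lam * ((1 - t) * ‖a‖))) :
    ‖volterra w f a‖ ≤ (∫ t in (0 : ℝ)..1, β t * t ^ σ) * K * weight σ lam a := by
  rw [volterra, mul_assoc, ← intervalIntegral.integral_mul_const]
  refine intervalIntegral.norm_integral_le_of_norm_le zero_le_one (.of_forall fun t ht => ?_)
    (hβ.mul_const _)
  have ht0 := ht.1
  have h1 := hf _ (hΩ.smul_mem ha ht)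
  rw [weight_smul ht0] at h1
  rw [volterraIntegrand, norm_mul, norm_mul]
  calc ‖w a (t * a)‖ * ‖f (t * a)‖ * ‖a‖ = ‖w a (t * a)‖ * ‖a‖ * ‖f (t * a)‖ := by ring
    _ ≤ (β t * Real.exp (lam * ((1 - t) * ‖a‖))) *
        (K * (t ^ σ * ‖a‖ ^ σ * Real.exp (lam * (t * ‖a‖)))) :=
      mul_le_mul (hw t ht) h1 (norm_nonneg _)
        ((mul_nonneg (norm_nonneg _) (norm_nonneg _)).trans (hw t ht))
    _ = β t * t ^ σ * (K * (‖a‖ ^ σ *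
        (Real.exp (lam * ((1 - t) * ‖a‖)) * Real.exp (lam * (t * ‖a‖))))) := by ring
    _ = _ := by
      rw [← Real.exp_add, weight]
      congr 5
      ring

theorem volterra_add {w : ℂ → ℂ → ℂ} {f g : ℂ → ℂ} {a : ℂ}
    (hf : IntervalIntegrable (volterraIntegrand w f a) volume 0 1)
    (hg : IntervalIntegrable (volterraIntegrand w g a) volume 0 1) :
    volterra w (f + g) a = volterra w f a + volterra w g a := by
  rw [volterra, volterra, volterra, ← intervalIntegral.integral_add hf hg]
  congr 1
  ext t
  simp only [volterraIntegrand, Pi.add_apply]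
  ring

theorem volterra_sub {w : ℂ → ℂ → ℂ} {f g : ℂ → ℂ} {a : ℂ}
    (hf : IntervalIntegrable (volterraIntegrand w f a) volume 0 1)
    (hg : IntervalIntegrable (volterraIntegrand w g a) volume 0 1) :
    volterra w (f - g) a = volterra w f a - volterra w g a := by
  rw [volterra, volterra, volterra, ← intervalIntegral.integral_sub hf hg]
  congr 1
  ext t
  simp only [volterraIntegrand, Pi.sub_apply]
  ring

end Operator

/-! ### Norm estimates for the two kernels -/

section Kernels

variable {Ω : Set ℂ}

theorem norm_sub_smul {a : ℂ} {t : ℝ} (ht : t ∈ Ioc (0 : ℝ) 1) :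
    ‖a - (t : ℂ) * a‖ = (1 - t) * ‖a‖ := by
  have : a - (t : ℂ) * a = ((1 - t : ℝ) : ℂ) * a := by push_cast; ring
  rw [this, norm_mul, Complex.norm_real, Real.norm_of_nonneg (by linarith [ht.2])]

theorem CondDiagZero.exists_nonneg {k : ℂ → ℂ → ℂ} {lam : ℝ} (h : CondDiagZero Ω k lam) :
    ∃ M lam' : ℝ, 0 ≤ M ∧ 0 ≤ lam' ∧ ∀ a ∈ Ω, ∀ a' ∈ Ω,
      ‖k a a'‖ ≤ M * (1 / ‖a‖ * Real.exp (lam' * ‖a - a'‖)) := by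
  obtain ⟨M, hM⟩ := h
  refine ⟨max M 0, max lam 0, le_max_right _ _, le_max_right _ _, fun a ha a' ha' =>
    (hM a ha a' ha').trans ?_⟩
  gcongr <;> exact le_max_left _ _

theorem CondDiagStar.exists_nonneg {k : ℂ → ℂ → ℂ} {γ lam : ℝ} (h : CondDiagStar Ω k γ lam) :
    ∃ M lam' : ℝ, 0 ≤ M ∧ 0 ≤ lam' ∧ ∀ a ∈ Ω, ∀ a' ∈ Ω,
      ‖k a a'‖ ≤ M * (‖a - a'‖ ^ γ / ‖a‖ * Real.exp (lam' * ‖a - a'‖)) := by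
  obtain ⟨-, M, hM⟩ := h
  refine ⟨max M 0, max lam 0, le_max_right _ _, le_max_right _ _, fun a ha a' ha' =>
    (hM a ha a' ha').trans ?_⟩
  gcongr <;> exact le_max_left _ _

theorem CondDiagZero.ray {k : ℂ → ℂ → ℂ} {M lam : ℝ} (hΩ : IsVolterraDomain Ω)
    (h : ∀ a ∈ Ω, ∀ a' ∈ Ω, ‖k a a'‖ ≤ M * (1 / ‖a‖ * Real.exp (lam * ‖a - a'‖)))
    {a : ℂ} (ha : a ∈ Ω) {t : ℝ} (ht : t ∈ Ioc (0 : ℝ) 1) :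
    ‖k a ((t : ℂ) * a)‖ * ‖a‖ ≤ M * Real.exp (lam * ((1 - t) * ‖a‖)) := by
  have ha0 : 0 < ‖a‖ := norm_pos_iff.2 (ne_of_mem_of_not_mem ha hΩ.zero_notMem)
  have := h a ha _ (hΩ.smul_mem ha ht)
  rw [norm_sub_smul ht] at this
  calc _ ≤ _ := mul_le_mul_of_nonneg_right this ha0.le
    _ = _ := by field_simp

theorem CondDiagStar.ray {k : ℂ → ℂ → ℂ} {M γ lam : ℝ} (hΩ : IsVolterraDomain Ω)
    (h : ∀ a ∈ Ω, ∀ a' ∈ Ω, ‖k a a'‖ ≤ M * (‖a - a'‖ ^ γ / ‖a‖ * Real.exp (lam * ‖a - a'‖)))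
    {a : ℂ} (ha : a ∈ Ω) {t : ℝ} (ht : t ∈ Ioc (0 : ℝ) 1) :
    ‖k a ((t : ℂ) * a)‖ * ‖a‖ ≤
      M * ((1 - t) * ‖a‖) ^ γ * Real.exp (lam * ((1 - t) * ‖a‖)) := by
  have ha0 : 0 < ‖a‖ := norm_pos_iff.2 (ne_of_mem_of_not_mem ha hΩ.zero_notMem)
  have := h a ha _ (hΩ.smul_mem ha ht)
  rw [norm_sub_smul ht] at this
  calc _ ≤ _ := mul_le_mul_of_nonneg_right this ha0.le
    _ = _ := by field_simp

theorem CondDiagZero.rayBounded {k : ℂ → ℂ → ℂ} {lam : ℝ} (hΩ : IsVolterraDomain Ω)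
    (h : CondDiagZero Ω k lam) : RayBounded Ω k := by
  obtain ⟨M, lam', hM, hlam', hk⟩ := h.exists_nonneg
  refine ⟨M, lam', hM, fun a ha t ht => (CondDiagZero.ray hΩ hk ha ht).trans ?_⟩
  gcongr
  exact mul_le_of_le_one_left (norm_nonneg _) (by linarith [ht.1])

theorem CondDiagStar.rayBounded {k : ℂ → ℂ → ℂ} {γ lam : ℝ} (hΩ : IsVolterraDomain Ω)
    (h : CondDiagStar Ω k γ lam) : RayBounded Ω k := by
  obtain ⟨M, lam', hM, hlam', hk⟩ := h.exists_nonneg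
  have hγ := h.1
  refine ⟨M * γ ^ γ, 1 + lam', by positivity, fun a ha t ht =>
    (CondDiagStar.ray hΩ hk ha ht).trans ?_⟩
  have h1 : (1 - t) * ‖a‖ ≤ ‖a‖ := mul_le_of_le_one_left (norm_nonneg _) (by linarith [ht.1])
  have h0 : 0 ≤ (1 - t) * ‖a‖ := mul_nonneg (by linarith [ht.2]) (norm_nonneg _)
  have h2 := rpow_le_mul_exp h.1 one_pos h0
  rw [div_one] at h2
  calc _ ≤ M * (γ ^ γ * Real.exp (1 * ((1 - t) * ‖a‖))) * Real.exp (lam' * ((1 - t) * ‖a‖)) := by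
        gcongr
    _ ≤ M * (γ ^ γ * Real.exp (1 * ‖a‖)) * Real.exp (lam' * ‖a‖) := by gcongr
    _ = _ := by rw [add_mul, Real.exp_add]; ring

/-- A kernel vanishing to order `γ` on the diagonal raises the order at `0` by `γ`. -/
theorem CondDiagStar.norm_volterra_le {k : ℂ → ℂ → ℂ} {γ lam : ℝ} (hΩ : IsVolterraDomain Ω)
    (h : CondDiagStar Ω k γ lam) {σ lam₁ K : ℝ} (hσ : -1 < σ) (hK : 0 ≤ K) {f : ℂ → ℂ}
    (hf : ∀ z ∈ Ω, ‖f z‖ ≤ K * weight σ lam₁ z) :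
    ∃ lam₂ K', 0 ≤ K' ∧ ∀ z ∈ Ω, ‖volterra k f z‖ ≤ K' * weight (σ + γ) lam₂ z := by
  obtain ⟨M, lam', hM, hlam', hk⟩ := h.exists_nonneg
  have hI : (∫ t in (0 : ℝ)..1, t ^ σ) = 1 / (σ + 1) := by
    rw [integral_rpow (.inl hσ), Real.one_rpow, Real.zero_rpow (by linarith), sub_zero]
  have hσ' : 0 < σ + 1 := by linarith
  refine ⟨max lam₁ lam', M * (1 / (σ + 1)) * K, by positivity, fun a ha => ?_⟩
  have ha0 : 0 < ‖a‖ := norm_pos_iff.2 (ne_of_mem_of_not_mem ha hΩ.zero_notMem)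
  have := SingularVolterra.norm_volterra_le hΩ (w := k) (lam := max lam₁ lam')
    (fun z hz => (hf z hz).trans (mul_le_mul_of_nonneg_left (weight_mono (le_max_left _ _) z) hK))
    -- Bounding `(1 - t) ^ γ` by `1` and keeping `‖a‖ ^ γ` is what raises the order.
    ha (β := fun _ => M * ‖a‖ ^ γ) ((intervalIntegral.intervalIntegrable_rpow' hσ).const_mul _)
    (by
      intro t ht
      have h1 : (1 - t) * ‖a‖ ≤ ‖a‖ := mul_le_of_le_one_left ha0.le (by linarith [ht.1])
      have h0 : 0 ≤ (1 - t) * ‖a‖ := mul_nonneg (by linarith [ht.2]) ha0.le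
      have hγ := h.1
      refine (CondDiagStar.ray hΩ hk ha ht).trans ?_
      gcongr
      exact le_max_right _ _)
  rw [intervalIntegral.integral_const_mul, hI] at this
  refine this.trans (le_of_eq ?_)
  rw [weight, weight, Real.rpow_add ha0]
  ring

/-- On spaces of large exponential type the perturbing operator is small. -/
theorem CondDiagStar.eventually_norm_volterra_le {k : ℂ → ℂ → ℂ} {γ lam : ℝ}
    (hΩ : IsVolterraDomain Ω) (h : CondDiagStar Ω k γ lam) {σ ε : ℝ} (hσ : -1 < σ) (hε : 0 < ε) :
    ∀ᶠ lam₁ : ℝ in atTop, ∀ (f : ℂ → ℂ) (K : ℝ), 0 ≤ K →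
      (∀ z ∈ Ω, ‖f z‖ ≤ K * weight σ lam₁ z) →
      ∀ z ∈ Ω, ‖volterra k f z‖ ≤ ε * K * weight σ lam₁ z := by
  obtain ⟨M, lam', hM, hlam', hk⟩ := h.exists_nonneg
  have hγ := h.1
  have hσ' : 0 < σ + 1 := by linarith
  have hI : (∫ t in (0 : ℝ)..1, t ^ σ) = 1 / (σ + 1) := by
    rw [integral_rpow (.inl hσ), Real.one_rpow, Real.zero_rpow (by linarith), sub_zero]
  -- The surplus rate `lam₁ - lam'` absorbs the power `((1 - t) ‖a‖) ^ γ` at the cost of this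
  -- vanishing constant.
  have hlim : Tendsto (fun lam₁ : ℝ => M * (γ / (lam₁ - lam')) ^ γ * (1 / (σ + 1))) atTop
      (𝓝 0) := by
    have h1 : Tendsto (fun lam₁ : ℝ => γ / (lam₁ - lam')) atTop (𝓝 0) :=
      (tendsto_atTop_add_const_right atTop (-lam') tendsto_id).const_div_atTop γ
    have h2 := h1.rpow_const (p := γ) (.inr hγ.le)
    rw [Real.zero_rpow hγ.ne'] at h2
    simpa using (h2.const_mul M).mul_const (1 / (σ + 1))
  filter_upwards [hlim.eventually_lt_const hε, eventually_gt_atTop lam'] with lam₁ h1 h2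
  intro f K hK hf a ha
  have hμ : 0 < lam₁ - lam' := by linarith
  have := SingularVolterra.norm_volterra_le hΩ (w := k) hf
    ha (β := fun _ => M * (γ / (lam₁ - lam')) ^ γ)
    ((intervalIntegral.intervalIntegrable_rpow' hσ).const_mul _)
    (by
      intro t ht
      have h0 : 0 ≤ (1 - t) * ‖a‖ := mul_nonneg (by linarith [ht.2]) (norm_nonneg a)
      refine (CondDiagStar.ray hΩ hk ha ht).trans ?_
      calc _ ≤ M * ((γ / (lam₁ - lam')) ^ γ * Real.exp ((lam₁ - lam') * ((1 - t) * ‖a‖))) *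
            Real.exp (lam' * ((1 - t) * ‖a‖)) := by
              gcongr
              exact rpow_le_mul_exp hγ hμ h0
        _ = M * (γ / (lam₁ - lam')) ^ γ * (Real.exp ((lam₁ - lam') * ((1 - t) * ‖a‖)) *
            Real.exp (lam' * ((1 - t) * ‖a‖))) := by ring
        _ = _ := by
          rw [← Real.exp_add]
          congr 2
          ring)
  rw [intervalIntegral.integral_const_mul, hI] at this
  refine this.trans ?_
  have := weight_nonneg σ lam₁ a
  gcongr

/-- On spaces of large exponential type and order `σ > τ - 1` the norm of the operator with
singular kernel is at most any `κ > τ / (σ + 1)`. -/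
theorem eventually_norm_volterra_le_of_condSing {k : ℂ → ℂ → ℂ} {τ lam : ℝ}
    (hΩ : IsVolterraDomain Ω) (hs : CondSing Ω k τ) (h : CondDiagZero Ω k lam) {σ κ : ℝ}
    (hσ : -1 < σ) (hκ : τ < κ * (σ + 1)) :
    ∀ᶠ lam₁ : ℝ in atTop, ∀ (f : ℂ → ℂ) (K : ℝ), 0 ≤ K →
      (∀ z ∈ Ω, ‖f z‖ ≤ K * weight σ lam₁ z) →
      ∀ z ∈ Ω, ‖volterra k f z‖ ≤ κ * K * weight σ lam₁ z := by
  obtain ⟨M, lam', hM, hlam', hk⟩ := h.exists_nonneg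
  obtain ⟨hτ, -, hs⟩ := hs
  have hσ' : 0 < σ + 1 := by linarith
  have hκ0 : 0 < κ := pos_of_mul_pos_left (hτ.trans hκ) hσ'.le
  have hI : (∫ t in (0 : ℝ)..1, t ^ σ) = 1 / (σ + 1) := by
    rw [integral_rpow (.inl hσ), Real.one_rpow, Real.zero_rpow (by linarith), sub_zero]
  obtain ⟨r, hr, hnear⟩ : ∃ r > 0, ∀ a ∈ Ω, ∀ a' ∈ Ω, ‖a‖ < r → ‖a'‖ < r →
      ‖k a a'‖ < κ * (σ + 1) / ‖a‖ := by
    obtain ⟨r, hr, h⟩ := Metric.eventually_nhds_iff.1 (eventually_nhdsWithin_iff.1 (hs _ hκ))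
    refine ⟨r, hr, fun a ha a' ha' h1 h2 => h (y := (a, a')) ?_ ⟨ha, ha'⟩⟩
    rw [Prod.dist_eq]
    simpa using ⟨h1, h2⟩
  -- For `‖a‖ ≥ r` the surplus rate damps the integrand at least this much. As `lam₁ → ∞` it tends
  -- to `0` for every `t < 1`, so dominated convergence applies.
  set φ : ℝ → ℝ → ℝ := fun lam₁ t => M * Real.exp (-(lam₁ - lam') * ((1 - t) * r)) * t ^ σ with hφ
  have hmeas : ∀ lam₁, AEStronglyMeasurable (φ lam₁) (volume.restrict (uIoc (0 : ℝ) 1)) := by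
    intro lam₁
    rw [uIoc_of_le zero_le_one]
    refine ContinuousOn.aestronglyMeasurable ?_ measurableSet_Ioc
    exact ContinuousOn.mul (by fun_prop)
      (continuousOn_id.rpow_const fun t ht => .inl ht.1.ne')
  have hdom : ∀ lam₁ : ℝ, lam' ≤ lam₁ → ∀ t ∈ Ioc (0 : ℝ) 1, ‖φ lam₁ t‖ ≤ M * t ^ σ := by
    intro lam₁ hl t ht
    have ht0 := ht.1
    rw [Real.norm_of_nonneg (by positivity)]
    have : Real.exp (-(lam₁ - lam') * ((1 - t) * r)) ≤ 1 := by
      rw [Real.exp_le_one_iff, neg_mul, neg_nonpos]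
      exact mul_nonneg (by linarith) (mul_nonneg (by linarith [ht.2]) hr.le)
    calc φ lam₁ t ≤ M * 1 * t ^ σ := by simp only [hφ]; gcongr
      _ = _ := by ring
  have hdomi : IntervalIntegrable (fun t : ℝ => M * t ^ σ) volume 0 1 :=
    (intervalIntegral.intervalIntegrable_rpow' hσ).const_mul _
  have hlim : Tendsto (fun lam₁ : ℝ => ∫ t in (0 : ℝ)..1, φ lam₁ t) atTop (𝓝 0) := by
    suffices h : Tendsto (fun lam₁ : ℝ => ∫ t in (0 : ℝ)..1, φ lam₁ t) atTop
        (𝓝 (∫ _ in (0 : ℝ)..1, (0 : ℝ))) by simpa using h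
    refine intervalIntegral.tendsto_integral_filter_of_dominated_convergence
      (fun t => M * t ^ σ) (.of_forall hmeas) ?_ hdomi ?_
    · filter_upwards [eventually_ge_atTop lam'] with lam₁ hl
      refine .of_forall fun t ht => ?_
      rw [uIoc_of_le zero_le_one] at ht
      exact hdom lam₁ hl t ht
    · have hne : ∀ᵐ t : ℝ, t ≠ 1 := by simp [ae_iff]
      filter_upwards [hne] with t ht1 ht
      rw [uIoc_of_le zero_le_one] at ht
      have hpos : 0 < (1 - t) * r := mul_pos (sub_pos.2 (lt_of_le_of_ne ht.2 ht1)) hr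
      have h1 : Tendsto (fun lam₁ : ℝ => (lam₁ - lam') * ((1 - t) * r)) atTop atTop :=
        (tendsto_atTop_add_const_right atTop (-lam') tendsto_id).atTop_mul_const hpos
      have h2 := ((Real.tendsto_exp_neg_atTop_nhds_zero.comp h1).const_mul M).mul_const (t ^ σ)
      simpa only [hφ, Function.comp_def, neg_mul, mul_zero, zero_mul] using h2
  filter_upwards [hlim.eventually_lt_const hκ0, eventually_ge_atTop lam'] with lam₁ h1 h2
  intro f K hK hf a ha
  have hW := weight_nonneg σ lam₁ a
  have ha0 : 0 < ‖a‖ := norm_pos_iff.2 (ne_of_mem_of_not_mem ha hΩ.zero_notMem)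
  -- Near `0` the constant `κ * (σ + 1)` times `∫ t ^ σ` is exactly `κ`; elsewhere the integral of
  -- `φ lam₁` is below `κ`.
  rcases lt_or_ge ‖a‖ r with har | har
  · have := norm_volterra_le hΩ (w := k) hf ha (β := fun _ => κ * (σ + 1))
      ((intervalIntegral.intervalIntegrable_rpow' hσ).const_mul _)
      (by
        intro t ht
        have h4 : ‖(t : ℂ) * a‖ < r := by
          rw [norm_mul, Complex.norm_real, Real.norm_of_nonneg ht.1.le]
          exact (mul_le_of_le_one_left ha0.le ht.2).trans_lt har
        have h3 := (hnear a ha _ (hΩ.smul_mem ha ht) har h4).le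
        rw [le_div_iff₀ ha0] at h3
        refine h3.trans (le_mul_of_one_le_right (by positivity) (Real.one_le_exp ?_))
        exact mul_nonneg (hlam'.trans h2) (mul_nonneg (by linarith [ht.2]) ha0.le))
    rw [intervalIntegral.integral_const_mul, hI] at this
    refine this.trans (le_of_eq ?_)
    field_simp
  · have := norm_volterra_le hΩ (w := k) hf ha
      (β := fun t => M * Real.exp (-(lam₁ - lam') * ((1 - t) * r)))
      (hdomi.mono_fun' (hmeas lam₁) (by
        rw [uIoc_of_le zero_le_one]
        exact (ae_restrict_iff' measurableSet_Ioc).2 (.of_forall (hdom lam₁ h2))))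
      (by
        intro t ht
        refine (CondDiagZero.ray hΩ hk ha ht).trans ?_
        rw [mul_assoc, ← Real.exp_add]
        have h5 : (lam₁ - lam') * ((1 - t) * r) ≤ (lam₁ - lam') * ((1 - t) * ‖a‖) :=
          mul_le_mul_of_nonneg_left (mul_le_mul_of_nonneg_left har (by linarith [ht.2]))
            (by linarith)
        gcongr
        linarith)
    refine this.trans ?_
    gcongr

end Kernels

/-! ### The prototype solution -/

section Prototype

variable {Ω : Set ℂ}

theorem hasDerivAt_smul_ray {f : ℂ → ℂ} {f' a : ℂ} {t : ℝ} (h : HasDerivAt f f' ((t : ℂ) * a)) :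
    HasDerivAt (fun s : ℝ => f ((s : ℂ) * a)) (f' * a) t := by
  have h1 : HasDerivAt (fun s : ℂ => s * a) a (t : ℂ) := by
    simpa using (hasDerivAt_id (t : ℂ)).mul_const a
  have h2 : HasDerivAt (fun s : ℂ => f (s * a)) (f' * a) (t : ℂ) := h.comp (t : ℂ) h1
  exact h2.comp_ofReal

/-- A bounded holomorphic function is integrated along the rays to a primitive vanishing at `0`. -/
theorem exists_primitive_of_bounded (hΩ : IsVolterraDomain Ω) {u : ℂ → ℂ}
    (hu : DifferentiableOn ℂ u Ω) {C : ℝ} (hC : ∀ z ∈ Ω, ‖u z‖ ≤ C) :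
    ∃ U : ℂ → ℂ, ∀ a ∈ Ω, HasDerivAt U (u a) a ∧ ‖U a‖ ≤ C * ‖a‖ := by
  have hd : ∀ z ∈ Ω, HasDerivAt u (deriv u z) z := fun z hz =>
    (hu.differentiableAt (hΩ.isOpen.mem_nhds hz)).hasDerivAt
  refine ⟨fun z => ∫ t in (0 : ℝ)..1, u ((t : ℂ) * z) * z, fun a ha => ⟨?_, ?_⟩⟩
  · have key := hasDerivAt_integral_of_dominated hΩ.isOpen
      (F := fun z t => u ((t : ℂ) * z) * z) (m := fun z => C * ‖z‖) (β := fun _ => 1)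
      (fun z hz => ContinuousOn.mul (hu.continuousOn.comp (by fun_prop)
        fun t ht => hΩ.smul_mem hz ht) continuousOn_const)
      (fun t ht => DifferentiableOn.mul (hu.comp (by fun_prop)
        fun z hz => hΩ.smul_mem hz ht) differentiableOn_id)
      (by fun_prop) intervalIntegrable_const (fun _ _ => zero_le_one)
      (fun z hz t ht => by
        rw [norm_mul, mul_one]
        exact mul_le_mul_of_nonneg_right (hC _ (hΩ.smul_mem hz ht)) (norm_nonneg z)) ha
    -- The derivative of `u (t z) z` in `z` equals that of `t u (t a)` in `t`, so its integral is `u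
    -- a` minus a limit at `0`, which vanishes since `u` is bounded.
    have hderiv : ∀ t ∈ Ioc (0 : ℝ) 1, HasDerivAt (fun s : ℝ => (s : ℂ) * u ((s : ℂ) * a))
        (deriv (fun z => u ((t : ℂ) * z) * z) a) t := by
      intro t ht
      have hmem := hΩ.smul_mem ha ht
      have h1 : HasDerivAt (fun z : ℂ => (t : ℂ) * z) (t : ℂ) a := by
        simpa using (hasDerivAt_id a).const_mul (t : ℂ)
      have h2 : HasDerivAt (fun z => u ((t : ℂ) * z)) (deriv u (t * a) * t) a :=
        (hd _ hmem).comp a h1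
      have h3 := (h2.mul (hasDerivAt_id a)).deriv
      have h4 : HasDerivAt (fun s : ℝ => (s : ℂ)) 1 t := Complex.ofRealCLM.hasDerivAt
      have h5 := h4.mul (hasDerivAt_smul_ray (hd _ hmem))
      simp only [Pi.mul_def, id] at h3 h5
      rw [h3]
      exact h5.congr_deriv (by ring)
    have h0 : Tendsto (fun s : ℝ => (s : ℂ) * u ((s : ℂ) * a)) (𝓝[>] 0) (𝓝 0) := by
      refine squeeze_zero_norm' (a := fun s : ℝ => s * C) ?_ ?_
      · filter_upwards [Ioc_mem_nhdsGT (zero_lt_one (α := ℝ))] with s hs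
        rw [norm_mul, Complex.norm_real, Real.norm_of_nonneg hs.1.le]
        exact mul_le_mul_of_nonneg_left (hC _ (hΩ.smul_mem ha hs)) hs.1.le
      · have : Tendsto (fun s : ℝ => s * C) (𝓝 0) (𝓝 (0 * C)) :=
          (continuous_id.mul continuous_const).tendsto 0
        rw [zero_mul] at this
        exact this.mono_left nhdsWithin_le_nhds
    have h1 := (hderiv 1 ⟨zero_lt_one, le_rfl⟩).continuousAt.tendsto.mono_left
      (nhdsWithin_le_nhds (s := Iio 1))
    have h2 := intervalIntegral.integral_eq_sub_of_hasDerivAt_of_tendsto zero_lt_one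
      (fun t ht => hderiv t ⟨ht.1, ht.2.le⟩) key.2.1 h0 h1
    have h3 := key.2.2
    rw [h2] at h3
    simpa using h3
  · have := intervalIntegral.norm_integral_le_of_norm_le_const (a := 0) (b := 1)
      (f := fun t : ℝ => u ((t : ℂ) * a) * a) (C := C * ‖a‖) (fun t ht => by
        rw [uIoc_of_le zero_le_one] at ht
        rw [norm_mul]
        exact mul_le_mul_of_nonneg_right (hC _ (hΩ.smul_mem ha ht)) (norm_nonneg a))
    simpa using this

/-- Simple connectivity gives a continuous logarithm; as a local right inverse of `exp` it is
holomorphic. -/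
theorem exists_log (hΩ : IsVolterraDomain Ω) :
    ∃ L : ℂ → ℂ, ∀ a ∈ Ω, HasDerivAt L a⁻¹ a ∧ Complex.exp (L a) = a := by
  obtain ⟨L, hL, hexp⟩ := Complex.exists_continuousOn_eqOn_exp_comp hΩ.simplyConnected hΩ.isOpen
    (g := id) continuousOn_id (by simpa using hΩ.zero_notMem)
  have he : ∀ a ∈ Ω, Complex.exp (L a) = a := fun a ha => hexp ha
  refine ⟨L, fun a ha => ⟨?_, he a ha⟩⟩
  have h := HasDerivAt.of_local_left_inverse (hL.continuousAt (hΩ.isOpen.mem_nhds ha))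
    (Complex.hasDerivAt_exp (L a)) (Complex.exp_ne_zero _)
    (by filter_upwards [hΩ.isOpen.mem_nhds ha] with z hz using he z hz)
  rwa [he a ha] at h

/-- A primitive removes the dependence on the chosen path. -/
theorem pathIntegral_eq_sub (hΩ : IsVolterraDomain Ω) {h H : ℂ → ℂ} (hh : ContinuousOn h Ω)
    (hH : ∀ a ∈ Ω, HasDerivAt H (h a) a) {a b : ℂ} (hb : b ∈ Ω) (ha : a ∈ Ω) :
    pathIntegral Ω h b a = H a - H b := by
  have hex := exists_isPathIn hΩ.isOpen
    hΩ.simplyConnected.isPathConnected.isConnected.isPreconnected hb ha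
  rw [pathIntegral, dif_pos hex]
  obtain ⟨hmem, hc⟩ := hex.choose_spec
  set γ := hex.choose
  have hext : ∀ t, γ.extend t ∈ Ω := fun t => hmem _
  have hω : ContinuousOn (fun z => h z • (1 : ℂ →L[ℂ] ℂ)) Ω := hh.smul continuousOn_const
  have hint := hω.curveIntegrable_of_contDiffOn hc hmem
  rw [curveIntegral_def]
  have := intervalIntegral.integral_eq_sub_of_hasDerivAt_of_le zero_le_one
    (f := fun t => H (γ.extend t)) (f' := curveIntegralFun (fun z => h z • (1 : ℂ →L[ℂ] ℂ)) γ)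
    (fun t _ => ((hH _ (hext t)).continuousAt.comp
      γ.continuous_extend.continuousAt).continuousWithinAt) ?_ hint
  · rw [this]; simp
  · intro t ht
    have hI : Icc (0 : ℝ) 1 ∈ 𝓝 t := Icc_mem_nhds ht.1 ht.2
    have hd : HasDerivAt γ.extend (derivWithin γ.extend (Icc 0 1) t) t :=
      ((hc.differentiableOn one_ne_zero t (mem_of_mem_nhds hI)).hasDerivWithinAt).hasDerivAt hI
    have := (hH _ (hext t)).scomp t hd
    rw [curveIntegralFun_def]
    exact this.congr_deriv (by simp [mul_comm])

variable {p q : ℂ → ℂ} {τ lam : ℝ}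

theorem differentiableOn_kernelZero (hp : DifferentiableOn ℂ p Ω) (hq : DifferentiableOn ℂ q Ω)
    (hp0 : ∀ a ∈ Ω, p a ≠ 0) :
    DifferentiableOn ℂ (fun x : ℂ × ℂ => kernelZero p q x.1 x.2) (Ω ×ˢ Ω) := by
  have h2 : DifferentiableOn ℂ (fun x : ℂ × ℂ => q x.2) (Ω ×ˢ Ω) :=
    hq.comp differentiableOn_snd fun x hx => hx.2
  have h1 : DifferentiableOn ℂ (fun x : ℂ × ℂ => p x.1) (Ω ×ˢ Ω) :=
    hp.comp differentiableOn_fst fun x hx => hx.1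
  simp only [kernelZero, div_eq_mul_inv]
  exact (h2.fun_mul (h1.fun_inv fun x hx => hp0 _ hx.1)).fun_neg

/-- Away from `0` both terms are `O(1 / ‖a‖)` separately, the exponential factor being `1` on the
diagonal; so the local bound becomes global. -/
theorem bounded_diagonal_sub {k : ℂ → ℂ → ℂ} (hs : CondSing Ω k τ)
    (h : CondDiagZero Ω k lam) :
    ∃ C, 0 ≤ C ∧ ∀ a ∈ Ω, ‖k a a - (τ : ℂ) / a‖ ≤ C := by
  obtain ⟨M, lam', hM, -, hk⟩ := h.exists_nonneg
  obtain ⟨hτ, ⟨C, hC⟩, -⟩ := hs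
  obtain ⟨r, hr, hnear⟩ := Metric.eventually_nhds_iff.1 (eventually_nhdsWithin_iff.1 hC)
  refine ⟨max C ((M + τ) / r), le_max_of_le_right (by positivity), fun a ha => ?_⟩
  rcases lt_or_ge ‖a‖ r with har | har
  · exact le_max_of_le_left (hnear (by simpa using har) ha)
  · refine le_max_of_le_right ((norm_sub_le _ _).trans ?_)
    have h1 := hk a ha a ha
    rw [sub_self, norm_zero, mul_zero, Real.exp_zero, mul_one] at h1
    rw [norm_div, Complex.norm_real, Real.norm_of_nonneg hτ.le]
    calc _ ≤ M * (1 / ‖a‖) + τ / ‖a‖ := by gcongr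
      _ = (M + τ) / ‖a‖ := by ring
      _ ≤ _ := by gcongr

/-- The exponential of a primitive of the diagonal of the kernel vanishes like `|a|^τ` at `0`. -/
theorem exists_primitive_diagonal (hΩ : IsVolterraDomain Ω)
    (hp : DifferentiableOn ℂ p Ω) (hq : DifferentiableOn ℂ q Ω) (hp0 : ∀ a ∈ Ω, p a ≠ 0)
    (hs : CondSing Ω (kernelZero p q) τ) (h : CondDiagZero Ω (kernelZero p q) lam) :
    ∃ (G : ℂ → ℂ) (C : ℝ), ∀ a ∈ Ω, HasDerivAt G (kernelZero p q a a) a ∧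
      ‖Complex.exp (G a)‖ ≤ weight τ C a := by
  obtain ⟨C, -, hC⟩ := bounded_diagonal_sub hs h
  obtain ⟨L, hL⟩ := exists_log hΩ
  have hne : ∀ a ∈ Ω, a ≠ 0 := fun a ha => ne_of_mem_of_not_mem ha hΩ.zero_notMem
  obtain ⟨U, hU⟩ := exists_primitive_of_bounded hΩ
    (u := fun a => kernelZero p q a a - (τ : ℂ) / a)
    (((hq.div hp hp0).neg).sub ((differentiableOn_const _).div differentiableOn_id hne)) hC
  -- The logarithm integrates `τ / a` and yields the factor `‖a‖ ^ τ`; the bounded remainder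
  -- contributes at most `exp (C ‖a‖)`.
  refine ⟨fun a => τ * L a + U a, C, fun a ha => ⟨?_, ?_⟩⟩
  · exact (((hL a ha).1.const_mul (τ : ℂ)).fun_add (hU a ha).1).congr_deriv (by
      rw [div_eq_mul_inv]; ring)
  · have h1 : ‖a‖ = Real.exp (L a).re := by rw [← Complex.norm_exp, (hL a ha).2]
    rw [Complex.norm_exp, weight, Complex.add_re, Real.exp_add, Complex.re_ofReal_mul]
    have h2 : ‖a‖ ^ τ = Real.exp (τ * (L a).re) := by rw [h1, ← Real.exp_mul, mul_comm]
    rw [h2]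
    gcongr
    exact (Complex.re_le_norm _).trans (hU a ha).2

/-- Freezing `a' = c` with `q c ≠ 0` turns the bound on k₀ into one on `1 / p`. -/
theorem exists_norm_inv_le (hΩ : IsVolterraDomain Ω)
    (hs : CondSing Ω (kernelZero p q) τ) (h : CondDiagZero Ω (kernelZero p q) lam) :
    ∃ K lam' : ℝ, 0 ≤ K ∧ ∀ a ∈ Ω, ‖(p a)⁻¹‖ ≤ K * weight (-1) lam' a := by
  obtain ⟨C, hC0, hC⟩ := bounded_diagonal_sub hs h
  obtain ⟨M, lam', hM, hlam', hk⟩ := h.exists_nonneg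
  have hτ := hs.1
  obtain ⟨c, hc, hq0⟩ : ∃ c ∈ Ω, q c ≠ 0 := by
    -- If `q c = 0`, the diagonal bound reads `τ / ‖c‖ ≤ C`, which fails for `‖c‖ < τ / (C + 1)`.
    obtain ⟨c, hc, hdist⟩ := Metric.mem_closure_iff.1 hΩ.touches_zero (τ / (C + 1)) (by positivity)
    refine ⟨c, hc, fun hq => ?_⟩
    rw [dist_zero_left, lt_div_iff₀ (by positivity)] at hdist
    have h1 := hC c hc
    have hc0 : 0 < ‖c‖ := norm_pos_iff.2 (ne_of_mem_of_not_mem hc hΩ.zero_notMem)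
    rw [kernelZero, hq, zero_div, neg_zero, zero_sub, norm_neg, norm_div, Complex.norm_real,
      Real.norm_of_nonneg hτ.le, div_le_iff₀ hc0] at h1
    linarith
  have hqc : 0 < ‖q c‖ := norm_pos_iff.2 hq0
  refine ⟨M * Real.exp (lam' * ‖c‖) / ‖q c‖, lam', by positivity, fun a ha => ?_⟩
  have h1 := hk a ha c hc
  rw [kernelZero, norm_neg, div_eq_mul_inv, norm_mul] at h1
  have h2 : Real.exp (lam' * ‖a - c‖) ≤ Real.exp (lam' * ‖c‖) * Real.exp (lam' * ‖a‖) := by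
    rw [← Real.exp_add, ← mul_add, add_comm]
    gcongr
    exact norm_sub_le _ _
  rw [weight, Real.rpow_neg_one, div_mul_eq_mul_div, le_div_iff₀ hqc, mul_comm]
  calc _ ≤ _ := h1
    _ ≤ M * (1 / ‖a‖ * (Real.exp (lam' * ‖c‖) * Real.exp (lam' * ‖a‖))) := by gcongr
    _ = _ := by ring

/-- The prototype solution grows like `|a|^(τ - 1)` at `0` and solves the unperturbed equation. -/
theorem prototype_spec (hΩ : IsVolterraDomain Ω)
    (hp : DifferentiableOn ℂ p Ω) (hq : DifferentiableOn ℂ q Ω) (hp0 : ∀ a ∈ Ω, p a ≠ 0)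
    (hs : CondSing Ω (kernelZero p q) τ) (h : CondDiagZero Ω (kernelZero p q) lam)
    {b : ℂ} (hb : b ∈ Ω) :
    (∃ lam' K, 0 ≤ K ∧ Dominated Ω (weight (τ - 1) lam') K (prototype Ω p q b)) ∧
    ∀ a ∈ Ω, volterra (kernelZero p q) (prototype Ω p q b) a = prototype Ω p q b a := by
  obtain ⟨G, C, hG⟩ := exists_primitive_diagonal hΩ hp hq hp0 hs h
  obtain ⟨K, lam', hK, hinv⟩ := exists_norm_inv_le hΩ hs h
  have hτ := hs.1
  -- On Ω this is `p` times the prototype, normalised to `1` at `b`.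
  set g : ℂ → ℂ := fun a => Complex.exp (G a) * Complex.exp (-G b) with hg
  have hproto : ∀ a ∈ Ω, prototype Ω p q b a = (p a)⁻¹ * g a := by
    intro a ha
    rw [prototype, pathIntegral_eq_sub hΩ (H := fun z => -G z) (hq.fun_div hp hp0).continuousOn
      (fun z hz => (hG z hz).1.fun_neg.congr_deriv (neg_neg _)) hb ha, one_div]
    simp only [hg]
    rw [← Complex.exp_add]
    congr 2
    ring
  have hgd : ∀ a ∈ Ω, HasDerivAt g (kernelZero p q a a * g a) a := by
    intro a ha
    exact (((hG a ha).1.cexp).mul_const (Complex.exp (-G b))).congr_deriv (by rw [hg]; ring)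
  have hgn : ∀ a ∈ Ω, ‖g a‖ ≤ ‖Complex.exp (-G b)‖ * weight τ C a := by
    intro a ha
    rw [hg, norm_mul, mul_comm]
    exact mul_le_mul_of_nonneg_left (hG a ha).2 (norm_nonneg _)
  have hdom : Dominated Ω (weight (τ - 1) (lam' + C)) (K * ‖Complex.exp (-G b)‖)
      (prototype Ω p q b) := by
    refine ⟨DifferentiableOn.congr (f := fun a => (p a)⁻¹ * g a) ((hp.inv hp0).mul fun a ha =>
      (hgd a ha).differentiableAt.differentiableWithinAt) hproto, fun a ha => ?_⟩
    have ha0 : 0 < ‖a‖ := norm_pos_iff.2 (ne_of_mem_of_not_mem ha hΩ.zero_notMem)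
    rw [hproto a ha, norm_mul]
    calc _ ≤ (K * weight (-1) lam' a) * (‖Complex.exp (-G b)‖ * weight τ C a) :=
          mul_le_mul (hinv a ha) (hgn a ha) (norm_nonneg _)
            (mul_nonneg hK (weight_nonneg _ _ _))
      _ = _ := by
        simp only [weight]
        rw [sub_eq_add_neg, Real.rpow_add ha0, add_mul, Real.exp_add]
        ring
  have hK' : 0 ≤ K * ‖Complex.exp (-G b)‖ := by positivity
  refine ⟨⟨_, _, hK', hdom⟩, fun a ha => ?_⟩
  have hint := (volterra_regular hΩ (differentiableOn_kernelZero hp hq hp0) (h.rayBounded hΩ)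
    (by linarith) hK' hdom).1 a ha
  -- Separability: `p (t a)` from the prototype cancels, so the integrand is `(p a)⁻¹` times the
  -- derivative of `g` along the ray.
  have heq : ∀ t ∈ Ioc (0 : ℝ) 1, volterraIntegrand (kernelZero p q) (prototype Ω p q b) a t =
      (p a)⁻¹ * (kernelZero p q (t * a) (t * a) * g (t * a) * a) := by
    intro t ht
    rw [volterraIntegrand, hproto _ (hΩ.smul_mem ha ht), kernelZero, kernelZero]
    ring
  have hderiv : ∀ t ∈ Ioc (0 : ℝ) 1, HasDerivAt (fun s : ℝ => (p a)⁻¹ * g ((s : ℂ) * a))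
      (volterraIntegrand (kernelZero p q) (prototype Ω p q b) a t) t := by
    intro t ht
    rw [heq t ht]
    exact (hasDerivAt_smul_ray (hgd _ (hΩ.smul_mem ha ht))).const_mul _
  have h0 : Tendsto (fun s : ℝ => (p a)⁻¹ * g ((s : ℂ) * a)) (𝓝[>] 0) (𝓝 0) := by
    refine squeeze_zero_norm' (a := fun s : ℝ => ‖(p a)⁻¹‖ * (‖Complex.exp (-G b)‖ *
      (s ^ τ * ‖a‖ ^ τ * Real.exp (C * (s * ‖a‖))))) ?_ ?_
    · filter_upwards [Ioc_mem_nhdsGT (zero_lt_one (α := ℝ))] with s hs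
      rw [norm_mul, ← weight_smul hs.1]
      exact mul_le_mul_of_nonneg_left (hgn _ (hΩ.smul_mem ha hs)) (norm_nonneg _)
    · have hc : Continuous fun s : ℝ => ‖(p a)⁻¹‖ * (‖Complex.exp (-G b)‖ *
          (s ^ τ * ‖a‖ ^ τ * Real.exp (C * (s * ‖a‖)))) := by
        have := Real.continuous_rpow_const hτ.le
        fun_prop
      have := (hc.tendsto 0).mono_left (nhdsWithin_le_nhds (s := Ioi 0))
      simpa [Real.zero_rpow hτ.ne'] using this
  have h1 := (hderiv 1 ⟨zero_lt_one, le_rfl⟩).continuousAt.tendsto.mono_left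
    (nhdsWithin_le_nhds (s := Iio 1))
  rw [volterra, intervalIntegral.integral_eq_sub_of_hasDerivAt_of_tendsto zero_lt_one
    (fun t ht => hderiv t ⟨ht.1, ht.2.le⟩) hint h0 h1, hproto a ha]
  simp

end Prototype

end SingularVolterra

/-! ### Existence and uniqueness -/

open SingularVolterra

theorem theorem3 (Ω : Set ℂ) (hΩ : SingularVolterra.IsVolterraDomain Ω)
    (p q : ℂ → ℂ) (hp : DifferentiableOn ℂ p Ω) (hq : DifferentiableOn ℂ q Ω)
    (hp0 : ∀ a ∈ Ω, p a ≠ 0)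
    (kstar : ℂ → ℂ → ℂ)
    (hk : DifferentiableOn ℂ (fun x : ℂ × ℂ => kstar x.1 x.2) (Ω ×ˢ Ω))
    (τ γ lam : ℝ)
    (hsing : SingularVolterra.CondSing Ω (SingularVolterra.kernelZero p q) τ)
    (hdiag : SingularVolterra.CondDiagZero Ω (SingularVolterra.kernelZero p q) lam)
    (hstar : SingularVolterra.CondDiagStar Ω kstar γ lam)
    (b : ℂ) (hb : b ∈ Ω) :
    -- the affine subspace lies in the space of order `τ - 1`, and so does the prototype solution
    SingularVolterra.prototype Ω p q b ∈ SingularVolterra.expSpaceUnion Ω (τ - 1) ∧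
    (∀ f : ℂ → ℂ,
      f - SingularVolterra.prototype Ω p q b ∈ SingularVolterra.expSpaceUnion Ω (τ - 1 + γ) →
      f ∈ SingularVolterra.expSpaceUnion Ω (τ - 1)) ∧
    -- existence and uniqueness, as functions on `Ω`
    ∃ f : ℂ → ℂ,
      (f - SingularVolterra.prototype Ω p q b ∈ SingularVolterra.expSpaceUnion Ω (τ - 1 + γ) ∧
        SingularVolterra.IsSolution Ω (SingularVolterra.kernelZero p q) kstar f) ∧
      ∀ g : ℂ → ℂ,
        g - SingularVolterra.prototype Ω p q b ∈ SingularVolterra.expSpaceUnion Ω (τ - 1 + γ) →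
        SingularVolterra.IsSolution Ω (SingularVolterra.kernelZero p q) kstar g →
        EqOn g f Ω := by
  have h0 := hΩ.zero_notMem
  have hτ := hsing.1
  have hγ := hstar.1
  have hk0 := differentiableOn_kernelZero hp hq hp0
  have hray0 := hdiag.rayBounded hΩ
  have hrays := hstar.rayBounded hΩ
  obtain ⟨⟨lam₁, K₁, hK₁, hproto⟩, hV0⟩ := prototype_spec hΩ hp hq hp0 hsing hdiag hb
  have hlow : -1 < τ - 1 := by linarith
  have hhigh : -1 < τ - 1 + γ := by linarith
  set f₀ := prototype Ω p q b with hf₀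
  have hincl : ∀ f : ℂ → ℂ, f - f₀ ∈ expSpaceUnion Ω (τ - 1 + γ) → f ∈ expSpaceUnion Ω (τ - 1) := by
    intro f hf
    obtain ⟨lam₂, K₂, hK₂, hf⟩ := (mem_expSpaceUnion_iff h0).1 hf
    have h1 := hf.lower h0 hγ hK₂
    have hpos : 0 ≤ K₂ * γ ^ γ := by positivity
    have h2 := (h1.mono (le_max_left (lam₂ + 1) lam₁) hpos le_rfl).add
      (hproto.mono (le_max_right (lam₂ + 1) lam₁) hK₁ le_rfl)
    rw [sub_add_cancel] at h2
    exact (mem_expSpaceUnion_iff h0).2 ⟨_, _, add_nonneg hpos hK₁, h2⟩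
  refine ⟨(mem_expSpaceUnion_iff h0).2 ⟨_, _, hK₁, hproto⟩, hincl, ?_⟩
  -- This lies strictly between the limiting norm `τ / (τ + γ)` of V₀ and `1`; half of the gap `1 -
  -- κ` is then granted to V⋆.
  set κ := (τ + γ / 2) / (τ + γ) with hκ
  have hκ1 : κ < 1 := by rw [hκ, div_lt_one (by positivity)]; linarith
  have hκ0 : 0 ≤ κ := by positivity
  obtain ⟨lam₀, hcontr⟩ := eventually_atTop.1
    ((eventually_norm_volterra_le_of_condSing hΩ hsing hdiag (σ := τ - 1 + γ) (κ := κ) hhigh (by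
      rw [hκ, show τ - 1 + γ + 1 = τ + γ by ring, div_mul_cancel₀ _ (by positivity)]
      linarith)).and
    (hstar.eventually_norm_volterra_le hΩ (σ := τ - 1 + γ) (ε := (1 - κ) / 2) hhigh (by linarith)))
  set T : (ℂ → ℂ) → ℂ → ℂ := fun f a => volterra (kernelZero p q) f a + volterra kstar f a with hT
  set κ' := κ + (1 - κ) / 2 with hκ'
  have hκ'0 : 0 ≤ κ' := by linarith
  have hκ'1 : κ' < 1 := by linarith
  have hTdom : ∀ lam', lam₀ ≤ lam' → ∀ f K, 0 ≤ K → Dominated Ω (weight (τ - 1 + γ) lam') K f →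
      Dominated Ω (weight (τ - 1 + γ) lam') (κ' * K) (T f) := by
    intro lam' hl f K hK hf
    refine ⟨(volterra_regular hΩ hk0 hray0 hhigh hK hf).2.add
      (volterra_regular hΩ hk hrays hhigh hK hf).2, fun z hz => ?_⟩
    rw [hκ', add_mul, add_mul]
    exact (norm_add_le _ _).trans (add_le_add ((hcontr _ hl).1 f K hK hf.2 z hz)
      ((hcontr _ hl).2 f K hK hf.2 z hz))
  have hintU : ∀ f ∈ expSpaceUnion Ω (τ - 1), ∀ a ∈ Ω,
      IntervalIntegrable (volterraIntegrand (kernelZero p q) f a) volume 0 1 ∧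
      IntervalIntegrable (volterraIntegrand kstar f a) volume 0 1 := by
    intro f hf a ha
    obtain ⟨lam₂, K₂, hK₂, hf⟩ := (mem_expSpaceUnion_iff h0).1 hf
    exact ⟨(volterra_regular hΩ hk0 hray0 hlow hK₂ hf).1 a ha,
      (volterra_regular hΩ hk hrays hlow hK₂ hf).1 a ha⟩
  have hTsub : ∀ f g, (∀ a ∈ Ω,
      IntervalIntegrable (volterraIntegrand (kernelZero p q) f a) volume 0 1 ∧
      IntervalIntegrable (volterraIntegrand kstar f a) volume 0 1) →
      (∀ a ∈ Ω,
      IntervalIntegrable (volterraIntegrand (kernelZero p q) g a) volume 0 1 ∧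
      IntervalIntegrable (volterraIntegrand kstar g a) volume 0 1) →
      ∀ z ∈ Ω, T (f - g) z = T f z - T g z := by
    intro f g hf hg z hz
    simp only [hT]
    rw [volterra_sub (hf z hz).1 (hg z hz).1, volterra_sub (hf z hz).2 (hg z hz).2]
    ring
  have hnn : ∀ {lam' K f}, Dominated Ω (weight (τ - 1 + γ) lam') K f →
      Dominated Ω (weight (τ - 1 + γ) lam') (max K 0) f := fun hf =>
    hf.mono le_rfl (le_max_right _ _) (le_max_left _ _)
  have hintD : ∀ {lam' K f}, Dominated Ω (weight (τ - 1 + γ) lam') K f → ∀ a ∈ Ω,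
      IntervalIntegrable (volterraIntegrand (kernelZero p q) f a) volume 0 1 ∧
      IntervalIntegrable (volterraIntegrand kstar f a) volume 0 1 := fun hf a ha =>
    ⟨(volterra_regular hΩ hk0 hray0 hhigh (le_max_right _ _) (hnn hf)).1 a ha,
      (volterra_regular hΩ hk hrays hhigh (le_max_right _ _) (hnn hf)).1 a ha⟩
  -- The source V⋆ f₀ of the equation for the correction has the order on which `T` contracts.
  obtain ⟨lam₂, K₂, hK₂, hh₀⟩ := hstar.norm_volterra_le hΩ hlow hK₁ hproto.2
  have hh₀' : Dominated Ω (weight (τ - 1 + γ) (max lam₀ lam₂)) K₂ (volterra kstar f₀) :=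
    Dominated.mono (le_max_right _ _) hK₂ le_rfl
      ⟨(volterra_regular hΩ hk hrays hlow hK₁ hproto).2, hh₀⟩
  obtain ⟨h, ⟨K, hhdom⟩, hfix⟩ := exists_dominated_fixedPoint hΩ.isOpen
    (continuousOn_weight h0 _ _) hκ'0 hκ'1 (hTdom _ (le_max_left lam₀ lam₂))
    (fun f g K K' hf hg => hTsub f g (hintD hf) (hintD hg)) hK₂ hh₀'
  have hmem : f₀ + h - f₀ ∈ expSpaceUnion Ω (τ - 1 + γ) := by
    rw [add_sub_cancel_left]
    exact (mem_expSpaceUnion_iff h0).2 ⟨_, _, le_max_right _ _, hnn hhdom⟩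
  have hf₀int := hintU f₀ ((mem_expSpaceUnion_iff h0).2 ⟨_, _, hK₁, hproto⟩)
  have hsol : IsSolution Ω (kernelZero p q) kstar (f₀ + h) := by
    intro a ha
    obtain ⟨h1, h2⟩ := hintU _ (hincl _ hmem) a ha
    refine ⟨h1, h2, ?_⟩
    rw [volterra_add (hf₀int a ha).1 (hintD hhdom a ha).1,
      volterra_add (hf₀int a ha).2 (hintD hhdom a ha).2, hV0 a ha, Pi.add_apply, hfix a ha]
    simp only [hT]
    ring
  refine ⟨f₀ + h, ⟨hmem, hsol⟩, fun g hg hgsol a ha => ?_⟩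
  obtain ⟨lam₃, K₃, hK₃, hg'⟩ := (mem_expSpaceUnion_iff h0).1 hg
  obtain ⟨lam₄, K₄, hK₄, hf'⟩ := (mem_expSpaceUnion_iff h0).1 hmem
  -- One type that accommodates both corrections and still makes `T` a contraction.
  set Λ := max lam₀ (max lam₃ lam₄) with hΛ
  have hd := (hg'.mono (lam' := Λ) ((le_max_left _ _).trans (le_max_right _ _)) hK₃ le_rfl).sub
    (hf'.mono (lam' := Λ) ((le_max_right _ _).trans (le_max_right _ _)) hK₄ le_rfl)
  rw [sub_sub_sub_cancel_right] at hd
  -- The solutions themselves are only known to have order `τ - 1`: their integrability splits `T`,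
  -- while the contraction acts on their difference.
  have hzero := eqOn_zero_of_fixedPoint hκ'0 hκ'1 (hTdom Λ (le_max_left _ _)) (by positivity) hd
    (fun z hz => by
      rw [hTsub _ _ (hintU g (hincl g hg)) (hintU _ (hincl _ hmem)) z hz, Pi.sub_apply,
        (hgsol z hz).2.2, (hsol z hz).2.2]) a ha
  exact sub_eq_zero.1 hzero
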